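/- Let $(M,g,J)$ be an almost Hermitian manifold: $M$ is a smooth manifold, $g$ a smooth Riemannian metric, $J$ a smooth almost complex structure with $g(JX,JY)=g(X,Y)$. Put $\omega(X,Y)=g(JX,Y)$ and $$N(X,Y)=J[JX,Y]+J[X,JY]+[X,Y]-[JX,JY],$$ let $d\omega$ be normalized by $$d\omega(X,Y,Z)=X\omega(Y,Z)+Y\omega(Z,X)+Z\omega(X,Y)-\omega([X,Y],Z)-\omega([Y,Z],X)-\omega([Z,X],Y),$$ and let $(d\omega)^+$ be the part of $d\omega$ of type $(2,1)+(1,2)$. A Hermitian connection is a smooth affine connection $\nabla$ on $M$ with $\nabla g=0$ and $\nabla J=0$; its torsion is $T(X,Y)=\nabla_XY-\nabla_YX-[X,Y]$, and the torsion is called totally skew-symmetric if $g(T(X,Y),Z)$ is skew-symmetric in $X,Y,Z$. For $t\in\mathbb{R}$ the $t$-Gauduchon connection is the connection $\nabla^t$ with $\nabla^t g=0$ whose torsion $T^t$ is given by $$g(T^t(X,Y),Z)=-\tfrac14 g(N(X,Y),Z)+\left(1-\tfrac t2\right)\cdot\tfrac12\left[(d\omega)^+(X,Y,JZ)-(d\omega)^+(JX,JY,JZ)\right]+\tfrac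 t2\,(d\omega)^+(JX,JY,JZ).$$ Then: 1. $(M,g,J)$ admits a Hermitian connection with totally skew-symmetric torsion if and only if $g(N(X,Y),Z)$ is totally skew-symmetric. 2. If $g(N(X,Y),Z)$ is totally skew-symmetric, then there is exactly one Hermitian connection with totally skew-symmetric torsion, and it is the $t=2$ Gauduchon connection. Its torsion satisfies $$g(T^2(X,Y),Z)=d\omega(JX,JY,JZ)-g(N(X,Y),Z).$$ -/

import Mathlib

open Bundle FiberBundle VectorField
open scoped Manifold ContDiff Topology

noncomputable section

variable {E : Type*} [NormedAddCommGroup E] [NormedSpace ℝ E]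
  {H : Type*} [TopologicalSpace H] {I : ModelWithCorners ℝ E H}
  {M : Type*} [TopologicalSpace M] [ChartedSpace H M] [IsManifold I ∞ M]

variable (I M) in
/-- A (smooth) almost Hermitian structure `(g, J)` on the manifold `M`: a smooth Riemannian metric
`g` and a smooth almost complex structure `J` which is orthogonal with respect to `g`. -/
structure AlmostHermitianStructure where
  /-- The Riemannian metric. -/
  metric : ContMDiffRiemannianMetric I ∞ E (fun x : M ↦ TangentSpace I x)
  /-- The almost complex structure. -/
  J : Π x : M, TangentSpace I x →L[ℝ] TangentSpace I x
  J_J : ∀ (x : M) (u : TangentSpace I x), J x (J x u) = -u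
  contMDiff_J : ContMDiff I (I.prod 𝓘(ℝ, E →L[ℝ] E)) ∞
    (fun x ↦ TotalSpace.mk' (E →L[ℝ] E)
      (E := fun x : M ↦ TangentSpace I x →L[ℝ] TangentSpace I x) x (J x))
  metric_J_J : ∀ (x : M) (u v : TangentSpace I x),
    metric.inner x (J x u) (J x v) = metric.inner x u v

/-- Total skew-symmetry of a family of trilinear maps on the tangent spaces. -/
def IsTotallySkew (τ : Π x : M, TangentSpace I x → TangentSpace I x → TangentSpace I x → ℝ) :
    Prop :=
  ∀ (x : M) (u v w : TangentSpace I x), τ x u v w = -τ x v u w ∧ τ x u v w = -τ x u w v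

/-- The complex trilinear extension of a real trilinear map `η` to the complexification of `V`.
A vector `a + i b` of the complexification is written as the pair `![a, b]`. -/
def complexTrilinear {V : Type*} (η : V → V → V → ℝ) (u v w : Fin 2 → V) : ℂ :=
  ∑ a : Fin 2, ∑ b : Fin 2, ∑ c : Fin 2,
    Complex.I ^ ((a : ℕ) + (b : ℕ) + (c : ℕ)) * (η (u a) (v b) (w c) : ℂ)

variable (I M) in
/-- Affine connections, i.e. covariant derivatives on the tangent bundle. `cov Y x u` is the value
of `∇_u Y` at the point `x`. -/
abbrev AffineConnection : Type _ := CovariantDerivative I E (fun x : M ↦ TangentSpace I x)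

/-- Two affine connections are the same if they agree on all vector fields, at all points where the
vector field is differentiable (at other points a `CovariantDerivative` has arbitrary values). -/
def SameConnection (cov cov' : AffineConnection I M) : Prop :=
  ∀ (x : M) (Y : Π x : M, TangentSpace I x), MDiffAt (T% Y) x → cov Y x = cov' Y x

namespace AlmostHermitianStructure

variable (S : AlmostHermitianStructure I M)

/-- The metric `g(u, v)`. -/
def g (x : M) (u v : TangentSpace I x) : ℝ := S.metric.inner x u v

/-- The fundamental form `ω(u, v) = g(J u, v)`. -/
def omega (x : M) (u v : TangentSpace I x) : ℝ := S.g x (S.J x u) v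

/-- The vector field `J X`. -/
def JField (X : Π x : M, TangentSpace I x) : Π x : M, TangentSpace I x := fun x ↦ S.J x (X x)

/-- `N(X, Y) = J[JX, Y] + J[X, JY] + [X, Y] - [JX, JY]` for vector fields `X`, `Y`. -/
def nijenhuisField (X Y : Π x : M, TangentSpace I x) (x : M) : TangentSpace I x :=
  S.J x (mlieBracket I (S.JField X) Y x) + S.J x (mlieBracket I X (S.JField Y) x)
    + mlieBracket I X Y x - mlieBracket I (S.JField X) (S.JField Y) x

/-- The function `dω(X, Y, Z)` for vector fields `X`, `Y`, `Z`, by the invariant formula for the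
exterior derivative (with the normalization without the factor `1/3`). -/
def dOmegaField (X Y Z : Π x : M, TangentSpace I x) (x : M) : ℝ :=
  d% (fun y ↦ S.omega y (Y y) (Z y)) x (X x)
    + d% (fun y ↦ S.omega y (Z y) (X y)) x (Y x)
    + d% (fun y ↦ S.omega y (X y) (Y y)) x (Z x)
    - S.omega x (mlieBracket I X Y x) (Z x)
    - S.omega x (mlieBracket I Y Z x) (X x)
    - S.omega x (mlieBracket I Z X x) (Y x)

/-- The 3-form `dω` at the point `x`. It is computed on extensions of the tangent vectors to vector
fields; by `dOmega_apply` the choice of the extensions does not matter. -/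
def dOmega (x : M) (u v w : TangentSpace I x) : ℝ :=
  S.dOmegaField (extend E u) (extend E v) (extend E w) x

/-- The component `u⁺ = (u - i J u) / 2` of type `(1,0)` of a real tangent vector. -/
def part10 (x : M) (u : TangentSpace I x) : Fin 2 → TangentSpace I x :=
  ![(1 / 2 : ℝ) • u, -((1 / 2 : ℝ) • S.J x u)]

/-- The component `u⁻ = (u + i J u) / 2` of type `(0,1)` of a real tangent vector. -/
def part01 (x : M) (u : TangentSpace I x) : Fin 2 → TangentSpace I x :=
  ![(1 / 2 : ℝ) • u, (1 / 2 : ℝ) • S.J x u]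

/-- The part `η⁺` of type `(2,1) + (1,2)` of a real 3-form `η` at `x`. The sum is invariant under
complex conjugation, hence real. -/
def plusPart (x : M) (η : TangentSpace I x → TangentSpace I x → TangentSpace I x → ℝ)
    (u v w : TangentSpace I x) : ℝ :=
  (complexTrilinear η (S.part10 x u) (S.part10 x v) (S.part01 x w)
    + complexTrilinear η (S.part10 x u) (S.part01 x v) (S.part10 x w)
    + complexTrilinear η (S.part01 x u) (S.part10 x v) (S.part10 x w)
    + complexTrilinear η (S.part01 x u) (S.part01 x v) (S.part10 x w)
    + complexTrilinear η (S.part01 x u) (S.part10 x v) (S.part01 x w)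
    + complexTrilinear η (S.part10 x u) (S.part01 x v) (S.part01 x w)).re

/-- `(dω)⁺`, the part of type `(2,1) + (1,2)` of `dω`. -/
def dOmegaPlus (x : M) (u v w : TangentSpace I x) : ℝ := S.plusPart x (S.dOmega x) u v w

/-- `g(θᶜ(u, v), w) = ((dω)⁺(u, v, Jw) - (dω)⁺(Ju, Jv, Jw)) / 2`. -/
def thetaC (x : M) (u v w : TangentSpace I x) : ℝ :=
  1 / 2 * (S.dOmegaPlus x u v (S.J x w) - S.dOmegaPlus x (S.J x u) (S.J x v) (S.J x w))

/-- `g(θᵇ(u, v), w) = (dω)⁺(Ju, Jv, Jw)`. -/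
def thetaB (x : M) (u v w : TangentSpace I x) : ℝ :=
  S.dOmegaPlus x (S.J x u) (S.J x v) (S.J x w)

/-- `∇g = 0`, that is, `X g(Y, Z) = g(∇_X Y, Z) + g(Y, ∇_X Z)`. -/
def IsMetricConnection (cov : AffineConnection I M) : Prop :=
  ∀ (x : M) (u : TangentSpace I x) (Y Z : Π x : M, TangentSpace I x),
    MDiffAt (T% Y) x → MDiffAt (T% Z) x →
      d% (fun y ↦ S.g y (Y y) (Z y)) x u
        = S.g x (cov Y x u) (Z x) + S.g x (Y x) (cov Z x u)

/-- A smooth affine connection is Hermitian if `∇g = 0` and `∇J = 0`, the latter meaning that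
`∇_X (JY) = J ∇_X Y`. -/
structure IsHermitian (cov : AffineConnection I M) : Prop where
  smooth : cov.ContMDiffCovariantDerivative ∞
  metric : S.IsMetricConnection cov
  parallel_J : ∀ (x : M) (u : TangentSpace I x) (Y : Π x : M, TangentSpace I x),
    MDiffAt (T% Y) x → cov (S.JField Y) x u = S.J x (cov Y x u)

lemma mdifferentiableAt_JField {X : Π x : M, TangentSpace I x} {x : M}
    (hX : MDiffAt (T% X) x) : MDiffAt (T% (S.JField X)) x :=
  MDifferentiableAt.clm_bundle_apply
    ((S.contMDiff_J x).mdifferentiableAt (by simp)) hX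

lemma mdifferentiableAt_g {X Y : Π x : M, TangentSpace I x} {x : M}
    (hX : MDiffAt (T% X) x) (hY : MDiffAt (T% Y) x) :
    MDiffAt (fun y ↦ S.g y (X y) (Y y)) x := by
  have h : MDifferentiableAt I (I.prod 𝓘(ℝ))
      (fun m ↦ TotalSpace.mk' ℝ (E := Bundle.Trivial M ℝ) m (S.metric.inner m (X m) (Y m))) x :=
    MDifferentiableAt.clm_bundle_apply₂ (F₁ := E) (F₂ := E)
      ((S.metric.contMDiff x).mdifferentiableAt (by simp)) hX hY
  rw [mdifferentiableAt_totalSpace] at h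
  exact h.2

lemma mdifferentiableAt_omega {X Y : Π x : M, TangentSpace I x} {x : M}
    (hX : MDiffAt (T% X) x) (hY : MDiffAt (T% Y) x) :
    MDiffAt (fun y ↦ S.omega y (X y) (Y y)) x :=
  S.mdifferentiableAt_g (S.mdifferentiableAt_JField hX) hY

lemma g_symm (x : M) (u v : TangentSpace I x) : S.g x u v = S.g x v u :=
  S.metric.symm x u v

lemma omega_swap (x : M) (u v : TangentSpace I x) : S.omega x u v = -S.omega x v u := by
  have h : S.g x (S.J x (S.J x u)) (S.J x v) = S.g x (S.J x u) v := S.metric_J_J x _ _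
  rw [S.J_J] at h
  rw [omega, omega, ← h, S.g_symm x (S.J x v) u]
  simp [g]

lemma omega_add_left (x : M) (u u' v : TangentSpace I x) :
    S.omega x (u + u') v = S.omega x u v + S.omega x u' v := by simp [omega, g]

lemma omega_smul_left (x : M) (a : ℝ) (u v : TangentSpace I x) :
    S.omega x (a • u) v = a * S.omega x u v := by simp [omega, g]

lemma omega_add_right (x : M) (u v v' : TangentSpace I x) :
    S.omega x u (v + v') = S.omega x u v + S.omega x u v' := by simp [omega, g]

lemma omega_smul_right (x : M) (a : ℝ) (u v : TangentSpace I x) :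
    S.omega x u (a • v) = a * S.omega x u v := by simp [omega, g]

lemma JField_smul (f : M → ℝ) (X : Π x : M, TangentSpace I x) :
    S.JField (f • X) = f • S.JField X := by
  ext x; simp [JField]

lemma JField_add (X X' : Π x : M, TangentSpace I x) :
    S.JField (X + X') = S.JField X + S.JField X' := by
  ext x; simp [JField]

lemma nijenhuisField_swap (X Y : Π x : M, TangentSpace I x) (x : M) :
    S.nijenhuisField X Y x = -S.nijenhuisField Y X x := by
  simp only [nijenhuisField]
  rw [mlieBracket_swap_apply (V := S.JField X) (W := Y),
    mlieBracket_swap_apply (V := X) (W := S.JField Y), mlieBracket_swap_apply (V := X) (W := Y),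
    mlieBracket_swap_apply (V := S.JField X) (W := S.JField Y)]
  simp only [map_neg]
  abel

lemma dOmegaField_rotate (X Y Z : Π x : M, TangentSpace I x) (x : M) :
    S.dOmegaField X Y Z x = S.dOmegaField Y Z X x := by
  simp only [dOmegaField]; ring

variable [CompleteSpace E]

lemma tensorialAt_nijenhuisField_left {x : M} (Y : Π x : M, TangentSpace I x)
    (_hY : MDiffAt (T% Y) x) : TensorialAt I E (fun X ↦ S.nijenhuisField X Y x) x where
  smul {f X} hf hX := by
    have hJX := S.mdifferentiableAt_JField hX
    simp only [nijenhuisField, JField_smul]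
    rw [mlieBracket_smul_left hf hX, mlieBracket_smul_left hf hJX, mlieBracket_smul_left hf hX,
      mlieBracket_smul_left hf hJX]
    simp only [map_add, map_smul, JField, J_J, map_neg, neg_smul]
    module
  add {X X'} hX hX' := by
    have hJX := S.mdifferentiableAt_JField hX
    have hJX' := S.mdifferentiableAt_JField hX'
    simp only [nijenhuisField, JField_add]
    rw [mlieBracket_add_left hX hX', mlieBracket_add_left hX hX', mlieBracket_add_left hJX hJX',
      mlieBracket_add_left hJX hJX']
    simp only [map_add]
    abel

lemma tensorialAt_nijenhuisField_right {x : M} (X : Π x : M, TangentSpace I x)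
    (hX : MDiffAt (T% X) x) : TensorialAt I E (fun Y ↦ S.nijenhuisField X Y x) x where
  smul {f Y} hf hY := by
    rw [S.nijenhuisField_swap, S.nijenhuisField_swap X,
      (S.tensorialAt_nijenhuisField_left X hX).smul hf hY, smul_neg]
  add {Y Y'} hY hY' := by
    rw [S.nijenhuisField_swap, S.nijenhuisField_swap X Y, S.nijenhuisField_swap X Y',
      (S.tensorialAt_nijenhuisField_left X hX).add hY hY', neg_add]

lemma tensorialAt_dOmegaField {x : M} {Y Z : Π x : M, TangentSpace I x}
    (hY : MDiffAt (T% Y) x) (hZ : MDiffAt (T% Z) x) :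
    TensorialAt I E (fun X ↦ S.dOmegaField X Y Z x) x where
  smul {f X} hf hX := by
    simp only [dOmegaField, Pi.smul_apply', omega_smul_left, omega_smul_right]
    rw [mlieBracket_smul_left hf hX, mlieBracket_smul_right hf hX,
      mvfderiv_fun_mul hf (S.mdifferentiableAt_omega hZ hX),
      mvfderiv_fun_mul hf (S.mdifferentiableAt_omega hX hY)]
    simp only [omega_smul_left, omega_add_left, S.omega_swap x (Z x) (X x)]
    simp
    ring
  add {X X'} hX hX' := by
    simp only [dOmegaField, Pi.add_apply, omega_add_left, omega_add_right]
    rw [mlieBracket_add_left hX hX', mlieBracket_add_right hX hX',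
      mvfderiv_fun_add (S.mdifferentiableAt_omega hZ hX) (S.mdifferentiableAt_omega hZ hX'),
      mvfderiv_fun_add (S.mdifferentiableAt_omega hX hY) (S.mdifferentiableAt_omega hX' hY)]
    simp only [omega_add_left]
    simp
    ring

variable [FiniteDimensional ℝ E]

/-- The Nijenhuis tensor `N` of `J`. -/
def nijenhuis (x : M) : TangentSpace I x →L[ℝ] TangentSpace I x →L[ℝ] TangentSpace I x :=
  TensorialAt.mkHom₂ (fun X Y ↦ S.nijenhuisField X Y x) x
    S.tensorialAt_nijenhuisField_left S.tensorialAt_nijenhuisField_right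

theorem nijenhuis_apply {x : M} {X Y : Π x : M, TangentSpace I x}
    (hX : MDiffAt (T% X) x) (hY : MDiffAt (T% Y) x) :
    S.nijenhuis x (X x) (Y x) = S.nijenhuisField X Y x :=
  TensorialAt.mkHom₂_apply _ _ hX hY

theorem dOmega_apply {x : M} {X Y Z : Π x : M, TangentSpace I x}
    (hX : MDiffAt (T% X) x) (hY : MDiffAt (T% Y) x) (hZ : MDiffAt (T% Z) x) :
    S.dOmega x (X x) (Y x) (Z x) = S.dOmegaField X Y Z x := by
  have eX := mdifferentiableAt_extend I E (X x)
  have eY := mdifferentiableAt_extend I E (Y x)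
  have eZ := mdifferentiableAt_extend I E (Z x)
  rw [dOmega, (S.tensorialAt_dOmegaField eY eZ).pointwise eX hX (by simp),
    S.dOmegaField_rotate, (S.tensorialAt_dOmegaField eZ hX).pointwise eY hY (by simp),
    S.dOmegaField_rotate, (S.tensorialAt_dOmegaField hX hY).pointwise eZ hZ (by simp),
    S.dOmegaField_rotate]

/-- The trilinear map `g(N(u, v), w)`. -/
def loweredNijenhuis (x : M) (u v w : TangentSpace I x) : ℝ := S.g x (S.nijenhuis x u v) w

/-- The torsion `g(Tᵗ(u, v), w)` of the Gauduchon connection with parameter `t`. -/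
def gauduchonTorsion (t : ℝ) (x : M) (u v w : TangentSpace I x) : ℝ :=
  -(1 / 4) * S.loweredNijenhuis x u v w + (1 - t / 2) * S.thetaC x u v w
    + t / 2 * S.thetaB x u v w

/-- The torsion `g(T(u, v), w)` of an affine connection, where
`T(X, Y) = ∇_X Y - ∇_Y X - [X, Y]`. -/
def loweredTorsion (cov : AffineConnection I M) (x : M) (u v w : TangentSpace I x) : ℝ :=
  S.g x (cov.torsion x u v) w

/-- `cov` is the Gauduchon connection with parameter `t`: the smooth metric connection with torsion
`Tᵗ`. -/
structure IsGauduchon (t : ℝ) (cov : AffineConnection I M) : Prop where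
  smooth : cov.ContMDiffCovariantDerivative ∞
  metric : S.IsMetricConnection cov
  torsion_eq : ∀ (x : M) (u v w : TangentSpace I x),
    S.loweredTorsion cov x u v w = S.gauduchonTorsion t x u v w

end AlmostHermitianStructure

end

/-! ### Smoothness criteria for functions and endomorphism fields -/

noncomputable section

variable {E : Type*} [NormedAddCommGroup E] [NormedSpace ℝ E]
  {H : Type*} [TopologicalSpace H] {I : ModelWithCorners ℝ E H}
  {M : Type*} [TopologicalSpace M] [ChartedSpace H M] [IsManifold I ∞ M]

/-! A metric connection with totally skew torsion `τ` satisfies `2 g(∇_X Y, Z) = koszul X Y Z + τ(X,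
Y, Z)`. So it is determined by `τ`, and conversely every smooth 3-form is the torsion of such a
connection (`koszulConnection`). The question is which `τ` make `J` parallel.

For a metric connection, `dω` and `N` are expressed through `∇J` and the torsion (`dOmega_eq`,
`loweredNijenhuis_eq`). If `∇J = 0` and `T` is skew, put `P(u, v, w) = T(Ju, Jv, w) + T(Ju, v, Jw) +
T(u, Jv, Jw)`. Then `dω(Ju, Jv, Jw) = P` and `N = P - T`. Hence `N` is skew and `T = dω(J·, J·, J·)
- N`, which gives necessity, uniqueness and the torsion formula; inserting the same expressions in
the Gauduchon torsion at `t = 2` returns `T`.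

If `N` is skew, this formula defines a 3-form, and the metric connection with that torsion is the
candidate. Comparing its torsion with the general expressions for `dω` and `N` cancels all torsion
terms and leaves a linear relation on `∇J`; with its cyclic permutations it forces `∇J = 0`
(`covJ_eq_zero`). -/

lemma ContMDiffAt.matrix_det {M : Type*} [TopologicalSpace M] {H E : Type*} [TopologicalSpace H]
    [NormedAddCommGroup E] [NormedSpace ℝ E] {I : ModelWithCorners ℝ E H} [ChartedSpace H M]
    {ι : Type*} [Fintype ι] [DecidableEq ι] {n : ℕ∞ω} {A : M → Matrix ι ι ℝ} {x : M}
    (hA : ∀ i j, ContMDiffAt I 𝓘(ℝ) n (fun y ↦ A y i j) x) :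
    ContMDiffAt I 𝓘(ℝ) n (fun y ↦ (A y).det) x := by
  simp only [Matrix.det_apply']
  exact ContMDiffAt.sum fun σ _ ↦ contMDiffAt_const.mul
    (contMDiffAt_finsetProd fun i _ ↦ hA _ _)

/-- The derivative of a smooth function along a smooth vector field is smooth. -/
lemma ContMDiffAt.mvfderiv_apply_section {f : M → ℝ} {X : Π x : M, TangentSpace I x} {x : M}
    (hf : ContMDiffAt I 𝓘(ℝ) ∞ f x) (hX : CMDiffAt ∞ (T% X) x) :
    ContMDiffAt I 𝓘(ℝ) ∞ (fun y ↦ d% f y (X y)) x := by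
  have h : ContMDiffAt I (𝓘(ℝ).prod 𝓘(ℝ)) ∞
      (fun m ↦ (⟨f m, mfderiv I 𝓘(ℝ) f m (X m)⟩ : TangentBundle 𝓘(ℝ) ℝ)) x :=
    ContMDiffAt.clm_apply_of_inCoordinates (F₁ := E) (F₂ := ℝ) (b₁ := id) (b₂ := f) (v := X)
      (ϕ := fun m ↦ mfderiv I 𝓘(ℝ) f m) (hf.mfderiv_const (by simp)) hX hf
  exact (contMDiff_snd_tangentBundle_modelSpace ℝ 𝓘(ℝ)).contMDiffAt.comp x h

section Frame

variable [FiniteDimensional ℝ E] {ι : Type*} [Fintype ι] (b : Module.Basis ι ℝ E)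

/-- A section of the endomorphism bundle is smooth if it maps a coordinate frame to smooth vector
fields. -/
lemma contMDiffAt_endomorphism_of_localFrame
    {A : Π x : M, TangentSpace I x →L[ℝ] TangentSpace I x} {x : M}
    (hA : ∀ i, CMDiffAt ∞ (T% (fun y ↦
      A y ((trivializationAt E (TangentSpace I) x).localFrame b i y))) x) :
    ContMDiffAt I (I.prod 𝓘(ℝ, E →L[ℝ] E)) ∞
      (fun y ↦ TotalSpace.mk' (E →L[ℝ] E)
        (E := fun x : M ↦ TangentSpace I x →L[ℝ] TangentSpace I x) y (A y)) x := by
  set e := trivializationAt E (TangentSpace I : M → Type _) x with he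
  have hx : x ∈ e.baseSet := FiberBundle.mem_baseSet_trivializationAt' x
  rw [contMDiffAt_hom_bundle]
  refine ⟨contMDiffAt_id, ?_⟩
  have hA' : ∀ i, ContMDiffAt I 𝓘(ℝ, E) ∞ (fun y ↦ (e ⟨y, A y (e.localFrame b i y)⟩).2) x :=
    fun i ↦ (e.contMDiffAt_section_iff hx).1 (hA i)
  -- In the trivialization `A` is the sum of (dual basis vector `i`) ⊗ (image of frame vector `i`):
  -- constant covectors times smooth vectors.
  have hsum : ContMDiffAt I 𝓘(ℝ, E →L[ℝ] E) ∞ (fun y ↦ ∑ i,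
      ContinuousLinearMap.smulRightL ℝ E E (LinearMap.toContinuousLinearMap (b.coord i))
        (e ⟨y, A y (e.localFrame b i y)⟩).2) x :=
    ContMDiffAt.sum fun i _ ↦ contMDiffAt_const.clm_apply (hA' i)
  refine hsum.congr_of_eventuallyEq ?_
  filter_upwards [e.open_baseSet.mem_nhds hx] with y hy
  rw [ContinuousLinearMap.inCoordinates_eq hy hy]
  apply ContinuousLinearMap.coe_injective
  refine b.ext fun j ↦ ?_
  rw [ContinuousLinearMap.coe_coe, ContinuousLinearMap.coe_coe, _root_.sum_apply,
    Finset.sum_eq_single j (fun i _ hij ↦ by simp [Finsupp.single_eq_of_ne hij])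
      (fun hj ↦ (hj (Finset.mem_univ j)).elim)]
  simp [hy, Bundle.Trivialization.basisAt, ← he]

end Frame

/-! ### Smoothness of a vector field tested with the metric -/

namespace AlmostHermitianStructure

variable (S : AlmostHermitianStructure I M)

lemma contMDiffAt_JField {X : Π x : M, TangentSpace I x} {x : M} (hX : CMDiffAt ∞ (T% X) x) :
    CMDiffAt ∞ (T% (S.JField X)) x :=
  ContMDiffAt.clm_bundle_apply (S.contMDiff_J x) hX

lemma contMDiffAt_g {X Y : Π x : M, TangentSpace I x} {x : M}
    (hX : CMDiffAt ∞ (T% X) x) (hY : CMDiffAt ∞ (T% Y) x) :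
    ContMDiffAt I 𝓘(ℝ) ∞ (fun y ↦ S.g y (X y) (Y y)) x := by
  have h : ContMDiffAt I (I.prod 𝓘(ℝ)) ∞
      (fun m ↦ TotalSpace.mk' ℝ (E := Bundle.Trivial M ℝ) m (S.metric.inner m (X m) (Y m))) x :=
    ContMDiffAt.clm_bundle_apply₂ (F₁ := E) (F₂ := E) (S.metric.contMDiff x) hX hY
  rw [contMDiffAt_totalSpace] at h
  exact h.2

lemma contMDiffAt_omega {X Y : Π x : M, TangentSpace I x} {x : M}
    (hX : CMDiffAt ∞ (T% X) x) (hY : CMDiffAt ∞ (T% Y) x) :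
    ContMDiffAt I 𝓘(ℝ) ∞ (fun y ↦ S.omega y (X y) (Y y)) x :=
  S.contMDiffAt_g (S.contMDiffAt_JField hX) hY

lemma g_add_left (x : M) (u u' v : TangentSpace I x) :
    S.g x (u + u') v = S.g x u v + S.g x u' v := by simp [g]

lemma g_smul_left (x : M) (a : ℝ) (u v : TangentSpace I x) :
    S.g x (a • u) v = a * S.g x u v := by simp [g]

lemma g_neg_left (x : M) (u v : TangentSpace I x) : S.g x (-u) v = -S.g x u v := by simp [g]

lemma g_sub_left (x : M) (u u' v : TangentSpace I x) :
    S.g x (u - u') v = S.g x u v - S.g x u' v := by simp [g]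

lemma g_add_right (x : M) (u v v' : TangentSpace I x) :
    S.g x u (v + v') = S.g x u v + S.g x u v' := by simp [g]

lemma g_smul_right (x : M) (a : ℝ) (u v : TangentSpace I x) :
    S.g x u (a • v) = a * S.g x u v := by simp [g]

lemma g_neg_right (x : M) (u v : TangentSpace I x) : S.g x u (-v) = -S.g x u v := by simp [g]

lemma g_J_left (x : M) (u v : TangentSpace I x) : S.g x (S.J x u) v = -S.g x u (S.J x v) := by
  have h : S.g x (S.J x (S.J x u)) (S.J x v) = S.g x (S.J x u) v := S.metric_J_J x _ _
  rw [← h, S.J_J, g_neg_left]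

lemma eq_of_g_eq {x : M} {u v : TangentSpace I x} (h : ∀ w, S.g x u w = S.g x v w) : u = v := by
  by_contra hne
  have := S.metric.pos x (u - v) (sub_ne_zero.2 hne)
  have h' := h (u - v)
  simp only [g] at h'
  simp [h'] at this

variable [FiniteDimensional ℝ E] {ι : Type*} [Fintype ι] (b : Module.Basis ι ℝ E)

/-- The frame coefficients of `V` solve a linear system whose matrix is the Gram matrix of the
frame. Cramer's rule writes them as quotients of smooth determinants. -/
lemma contMDiffAt_of_g_localFrame {V : Π x : M, TangentSpace I x} {x : M}
    (hV : ∀ i, ContMDiffAt I 𝓘(ℝ) ∞ (fun y ↦ S.g y (V y)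
      ((trivializationAt E (TangentSpace I) x).localFrame b i y)) x) :
    CMDiffAt ∞ (T% V) x := by
  classical
  set e := trivializationAt E (TangentSpace I : M → Type _) x with he
  have hx : x ∈ e.baseSet := FiberBundle.mem_baseSet_trivializationAt' x
  let c : M → ι → ℝ := fun y i ↦ e.localFrameCoeff I b i y (V y)
  let f : M → ι → ℝ := fun y j ↦ S.g y (V y) (e.localFrame b j y)
  let G : M → Matrix ι ι ℝ := fun y ↦
    Matrix.of fun i j ↦ S.g y (e.localFrame b j y) (e.localFrame b i y)
  have hs : ∀ i, CMDiffAt ∞ (T% (e.localFrame b i)) x := fun i ↦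
    contMDiffAt_localFrame_of_mem ∞ e b i hx
  have hG : ∀ i j, ContMDiffAt I 𝓘(ℝ) ∞ (fun y ↦ G y i j) x := fun i j ↦
    S.contMDiffAt_g (hs j) (hs i)
  have g_sum : ∀ (y : M) (a : ι → ℝ) (w : TangentSpace I y),
      S.g y (∑ i, a i • e.localFrame b i y) w = ∑ i, a i * S.g y (e.localFrame b i y) w := by
    intro y a w
    simp [g]
  have hGc : ∀ y ∈ e.baseSet, (G y).mulVec (c y) = f y := by
    intro y hy
    ext j
    have h := e.eq_sum_localFrameCoeff_smul (I := I) (b := b) (s := V) hy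
    change _ = S.g y (V y) _
    conv_rhs => rw [h, g_sum]
    simp only [Matrix.mulVec, dotProduct, G, c, Matrix.of_apply]
    exact Finset.sum_congr rfl fun i _ ↦ mul_comm _ _
  -- A kernel vector of the Gram matrix gives a combination of frame vectors orthogonal to the
  -- frame, hence to itself, hence zero.
  have hdet : (G x).det ≠ 0 := by
    intro h0
    obtain ⟨v, hv, hv0⟩ := Matrix.exists_mulVec_eq_zero_iff.2 h0
    have hz : ∑ i, v i • e.localFrame b i x = 0 := by
      by_contra hne
      have hpos : 0 < S.g x (∑ i, v i • e.localFrame b i x) (∑ i, v i • e.localFrame b i x) :=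
        S.metric.pos x _ hne
      have h1 : ∀ j, S.g x (∑ i, v i • e.localFrame b i x) (e.localFrame b j x) = 0 := by
        intro j
        rw [g_sum]
        refine Eq.trans ?_ (congrFun hv0 j)
        exact Finset.sum_congr rfl fun i _ ↦ mul_comm _ _
      rw [g_sum] at hpos
      simp_rw [S.g_symm x (e.localFrame b _ x)] at hpos
      simp [h1] at hpos
    have hli : LinearIndependent ℝ (fun i ↦ e.localFrame b i x) :=
      (e.isLocalFrameOn_localFrame_baseSet I 1 b).linearIndependent hx
    exact hv (funext (Fintype.linearIndependent_iff.1 hli v hz))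
  have hdet_smooth : ContMDiffAt I 𝓘(ℝ) ∞ (fun y ↦ (G y).det) x := .matrix_det hG
  rw [contMDiffAt_iff_localFrameCoeff b hx]
  intro i
  have hcr : ContMDiffAt I 𝓘(ℝ) ∞ (fun y ↦ ((G y).updateCol i (f y)).det) x := by
    refine .matrix_det fun k l ↦ ?_
    by_cases hl : l = i
    · subst hl
      simpa using hV k
    · simpa [Matrix.updateCol_apply, hl] using hG k l
  refine (hcr.mul (hdet_smooth.inv₀ hdet)).congr_of_eventuallyEq ?_
  filter_upwards [e.open_baseSet.mem_nhds hx,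
    hdet_smooth.continuousAt.eventually_ne hdet] with y hy hy0
  change c y i = ((G y).updateCol i (f y)).det * (G y).det⁻¹
  rw [← Matrix.cramer_apply, Matrix.cramer_eq_adjugate_mulVec, ← hGc y hy, Matrix.mulVec_mulVec,
    Matrix.adjugate_mul, Matrix.smul_mulVec, Matrix.one_mulVec]
  simp only [Pi.smul_apply, smul_eq_mul]
  field_simp

end AlmostHermitianStructure

/-! ### The Koszul formula with prescribed skew torsion -/

namespace AlmostHermitianStructure

variable (S : AlmostHermitianStructure I M)

/-- The right hand side of the Koszul formula. -/
def koszul (X Y Z : Π x : M, TangentSpace I x) (x : M) : ℝ :=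
  d% (fun y ↦ S.g y (Y y) (Z y)) x (X x)
    + d% (fun y ↦ S.g y (X y) (Z y)) x (Y x)
    - d% (fun y ↦ S.g y (X y) (Y y)) x (Z x)
    + S.g x (mlieBracket I X Y x) (Z x)
    - S.g x (mlieBracket I X Z x) (Y x)
    - S.g x (mlieBracket I Y Z x) (X x)

lemma koszul_sub_swap (X Y Z : Π x : M, TangentSpace I x) (x : M) :
    S.koszul X Y Z x - S.koszul Y X Z x = 2 * S.g x (mlieBracket I X Y x) (Z x) := by
  simp only [koszul, fun y ↦ S.g_symm y (Y y) (X y)]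
  rw [mlieBracket_swap_apply (V := Y) (W := X), g_neg_left]
  ring

lemma koszul_add_swap (X Y Z : Π x : M, TangentSpace I x) (x : M) :
    S.koszul X Y Z x + S.koszul X Z Y x = 2 * d% (fun y ↦ S.g y (Y y) (Z y)) x (X x) := by
  simp only [koszul, fun y ↦ S.g_symm y (Z y) (Y y)]
  rw [mlieBracket_swap_apply (V := Z) (W := Y), g_neg_left]
  ring

/-- A smooth 3-form. -/
structure IsSmoothThreeForm
    (τ : Π x : M, TangentSpace I x → TangentSpace I x → TangentSpace I x → ℝ) : Prop where
  skew : IsTotallySkew τ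
  add_left : ∀ (x : M) (u u' v w : TangentSpace I x), τ x (u + u') v w = τ x u v w + τ x u' v w
  smul_left : ∀ (x : M) (a : ℝ) (u v w : TangentSpace I x), τ x (a • u) v w = a * τ x u v w
  contMDiffAt : ∀ (x : M) (X Y Z : Π x : M, TangentSpace I x),
    CMDiffAt ∞ (T% X) x → CMDiffAt ∞ (T% Y) x → CMDiffAt ∞ (T% Z) x →
      ContMDiffAt I 𝓘(ℝ) ∞ (fun y ↦ τ y (X y) (Y y) (Z y)) x

omit [IsManifold I ∞ M] in
lemma _root_.IsTotallySkew.rotate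
    {τ : Π x : M, TangentSpace I x → TangentSpace I x → TangentSpace I x → ℝ}
    (h : IsTotallySkew τ) (x : M) (u v w : TangentSpace I x) : τ x u v w = τ x v w u := by
  rw [(h x u v w).1, (h x v u w).2, neg_neg]

variable {τ : Π x : M, TangentSpace I x → TangentSpace I x → TangentSpace I x → ℝ}

namespace IsSmoothThreeForm

lemma add_middle (hτ : IsSmoothThreeForm τ) (x : M) (u v v' w : TangentSpace I x) :
    τ x u (v + v') w = τ x u v w + τ x u v' w := by
  rw [hτ.skew.rotate, hτ.add_left, ← hτ.skew.rotate x u v, ← hτ.skew.rotate x u v']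

lemma smul_middle (hτ : IsSmoothThreeForm τ) (x : M) (a : ℝ) (u v w : TangentSpace I x) :
    τ x u (a • v) w = a * τ x u v w := by
  rw [hτ.skew.rotate, hτ.smul_left, ← hτ.skew.rotate]

lemma add_right (hτ : IsSmoothThreeForm τ) (x : M) (u v w w' : TangentSpace I x) :
    τ x u v (w + w') = τ x u v w + τ x u v w' := by
  rw [hτ.skew.rotate, hτ.add_middle, ← hτ.skew.rotate x u v, ← hτ.skew.rotate x u v]

lemma smul_right (hτ : IsSmoothThreeForm τ) (x : M) (a : ℝ) (u v w : TangentSpace I x) :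
    τ x u v (a • w) = a * τ x u v w := by
  rw [hτ.skew.rotate, hτ.smul_middle, ← hτ.skew.rotate]

end IsSmoothThreeForm

/-- Riesz representation: `u ↦ g(u, ·)` is injective, hence an isomorphism onto the dual in finite
dimension. -/
lemma exists_g_eq_bilinear [FiniteDimensional ℝ E] {x : M}
    (B : TangentSpace I x →L[ℝ] TangentSpace I x →L[ℝ] ℝ) :
    ∃ L : TangentSpace I x →L[ℝ] TangentSpace I x, ∀ u w, S.g x (L u) w = B u w := by
  have : FiniteDimensional ℝ (TangentSpace I x) := inferInstanceAs (FiniteDimensional ℝ E)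
  have : T2Space (TangentSpace I x) := inferInstanceAs (T2Space E)
  let φ : TangentSpace I x →ₗ[ℝ] Module.Dual ℝ (TangentSpace I x) :=
    { toFun := fun u ↦ (S.metric.inner x u : TangentSpace I x →ₗ[ℝ] ℝ)
      map_add' := fun u v ↦ by ext; simp
      map_smul' := fun a u ↦ by ext; simp }
  have hφ : Function.Injective φ := fun u v h ↦ S.eq_of_g_eq fun w ↦ congr($h w)
  let e := LinearMap.linearEquivOfInjective φ hφ (Subspace.dual_finrank_eq).symm
  let β : TangentSpace I x →ₗ[ℝ] Module.Dual ℝ (TangentSpace I x) :=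
    { toFun := fun u ↦ (B u : TangentSpace I x →ₗ[ℝ] ℝ)
      map_add' := fun u v ↦ by ext; simp
      map_smul' := fun a u ↦ by ext; simp }
  refine ⟨LinearMap.toContinuousLinearMap (e.symm.toLinearMap ∘ₗ β), fun u w ↦ ?_⟩
  have h : φ (e.symm (β u)) = β u := e.apply_symm_apply (β u)
  exact congr($h w)

variable [CompleteSpace E]

lemma contMDiffAt_mlieBracket {X Y : Π x : M, TangentSpace I x} {x : M}
    (hX : CMDiffAt ∞ (T% X) x) (hY : CMDiffAt ∞ (T% Y) x) :
    CMDiffAt ∞ (T% (mlieBracket I X Y)) x :=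
  have : IsManifold I (minSmoothness ℝ 2) M := by
    rw [minSmoothness_of_isRCLikeNormedField]; infer_instance
  have : IsManifold I (((⊤ : ℕ∞) : ℕ∞ω) + 1) M := inferInstanceAs (IsManifold I ∞ M)
  ContMDiffAt.mlieBracket_vectorField (m := ⊤) (n := ⊤) hX hY (by simp)

lemma contMDiffAt_koszul {X Y Z : Π x : M, TangentSpace I x} {x : M}
    (hX : CMDiffAt ∞ (T% X) x) (hY : CMDiffAt ∞ (T% Y) x) (hZ : CMDiffAt ∞ (T% Z) x) :
    ContMDiffAt I 𝓘(ℝ) ∞ (S.koszul X Y Z) x :=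
  (((((((S.contMDiffAt_g hY hZ).mvfderiv_apply_section hX).add
    ((S.contMDiffAt_g hX hZ).mvfderiv_apply_section hY)).sub
    ((S.contMDiffAt_g hX hY).mvfderiv_apply_section hZ)).add
    (S.contMDiffAt_g (contMDiffAt_mlieBracket hX hY) hZ)).sub
    (S.contMDiffAt_g (contMDiffAt_mlieBracket hX hZ) hY)).sub
    (S.contMDiffAt_g (contMDiffAt_mlieBracket hY hZ) hX))

lemma tensorialAt_koszul_left {x : M} {Y Z : Π x : M, TangentSpace I x}
    (hY : MDiffAt (T% Y) x) (hZ : MDiffAt (T% Z) x) :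
    TensorialAt I E (fun X ↦ S.koszul X Y Z x) x where
  smul {f X} hf hX := by
    simp only [koszul, Pi.smul_apply', g_smul_left, g_smul_right]
    rw [mlieBracket_smul_left hf hX, mlieBracket_smul_left hf hX,
      mvfderiv_fun_mul hf (S.mdifferentiableAt_g hX hZ),
      mvfderiv_fun_mul hf (S.mdifferentiableAt_g hX hY)]
    simp only [g_smul_left, g_add_left, S.g_symm x (X x) (Z x)]
    simp [S.g_symm x (Z x) (X x)]
    ring
  add {X X'} hX hX' := by
    simp only [koszul, Pi.add_apply, g_add_left, g_add_right]
    rw [mlieBracket_add_left hX hX', mlieBracket_add_left hX hX',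
      mvfderiv_fun_add (S.mdifferentiableAt_g hX hZ) (S.mdifferentiableAt_g hX' hZ),
      mvfderiv_fun_add (S.mdifferentiableAt_g hX hY) (S.mdifferentiableAt_g hX' hY)]
    simp only [g_add_left]
    simp
    ring

lemma tensorialAt_koszul_right {x : M} {X Y : Π x : M, TangentSpace I x}
    (hX : MDiffAt (T% X) x) (hY : MDiffAt (T% Y) x) :
    TensorialAt I E (fun Z ↦ S.koszul X Y Z x) x where
  smul {f Z} hf hZ := by
    simp only [koszul, Pi.smul_apply', g_smul_right]
    rw [mlieBracket_smul_right hf hZ, mlieBracket_smul_right hf hZ,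
      mvfderiv_fun_mul hf (S.mdifferentiableAt_g hX hZ),
      mvfderiv_fun_mul hf (S.mdifferentiableAt_g hY hZ)]
    simp only [g_smul_left, g_add_left]
    simp [S.g_symm x (Z x)]
    ring
  add {Z Z'} hZ hZ' := by
    simp only [koszul, Pi.add_apply, g_add_right]
    rw [mlieBracket_add_right hZ hZ', mlieBracket_add_right hZ hZ',
      mvfderiv_fun_add (S.mdifferentiableAt_g hX hZ) (S.mdifferentiableAt_g hX hZ'),
      mvfderiv_fun_add (S.mdifferentiableAt_g hY hZ) (S.mdifferentiableAt_g hY hZ')]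
    simp only [g_add_left]
    simp
    ring

/-- By `koszul_sub_swap`, exchanging the first two fields costs only a bracket term, so the
behaviour in `Y` follows from tensoriality in the first slot and the rules for the bracket. The
Leibniz rule below arises in the same way. -/
lemma koszul_add_middle {x : M} {X Y Y' Z : Π x : M, TangentSpace I x}
    (hX : MDiffAt (T% X) x) (hY : MDiffAt (T% Y) x) (hY' : MDiffAt (T% Y') x)
    (hZ : MDiffAt (T% Z) x) :
    S.koszul X (Y + Y') Z x = S.koszul X Y Z x + S.koszul X Y' Z x := by
  have h := (S.tensorialAt_koszul_left hX hZ).add hY hY'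
  have h₁ := S.koszul_sub_swap X (Y + Y') Z x
  have h₂ := S.koszul_sub_swap X Y Z x
  have h₃ := S.koszul_sub_swap X Y' Z x
  rw [mlieBracket_add_right hY hY', g_add_left] at h₁
  linarith

lemma koszul_smul_middle {x : M} {f : M → ℝ} {X Y Z : Π x : M, TangentSpace I x}
    (hf : MDiffAt f x) (hX : MDiffAt (T% X) x) (hY : MDiffAt (T% Y) x) (hZ : MDiffAt (T% Z) x) :
    S.koszul X (f • Y) Z x = f x * S.koszul X Y Z x + 2 * (d% f x (X x) * S.g x (Y x) (Z x)) := by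
  have h := (S.tensorialAt_koszul_left hX hZ).smul hf hY
  have h₁ := S.koszul_sub_swap X (f • Y) Z x
  have h₂ := S.koszul_sub_swap X Y Z x
  rw [mlieBracket_smul_right hf hY] at h₁
  simp only [g_add_left, g_smul_left, smul_eq_mul] at h h₁
  linear_combination h + h₁ - f x * h₂

variable [FiniteDimensional ℝ E]

/-- For fixed `Y` the right side is tensorial in `X` and `Z`, so it is a bilinear form on the
tangent space, to be represented by the metric. -/
lemma exists_koszul_eq (hτ : IsSmoothThreeForm τ) {x : M} {Y : Π x : M, TangentSpace I x}
    (hY : MDiffAt (T% Y) x) :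
    ∃ L : TangentSpace I x →L[ℝ] TangentSpace I x, ∀ X Z : Π x : M, TangentSpace I x,
      MDiffAt (T% X) x → MDiffAt (T% Z) x →
        2 * S.g x (L (X x)) (Z x) = S.koszul X Y Z x + τ x (X x) (Y x) (Z x) := by
  have h₁ : ∀ Z : Π x : M, TangentSpace I x, MDiffAt (T% Z) x →
      TensorialAt I E (fun X ↦ 1 / 2 * (S.koszul X Y Z x + τ x (X x) (Y x) (Z x))) x :=
    fun Z hZ ↦
    { smul := fun {f X} hf hX ↦ by
        have := (S.tensorialAt_koszul_left hY hZ).smul hf hX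
        simp only [smul_eq_mul, Pi.smul_apply', hτ.smul_left] at this ⊢
        rw [this]; ring
      add := fun {X X'} hX hX' ↦ by
        have := (S.tensorialAt_koszul_left hY hZ).add hX hX'
        simp only [Pi.add_apply, hτ.add_left] at this ⊢
        rw [this]; ring }
  have h₂ : ∀ X : Π x : M, TangentSpace I x, MDiffAt (T% X) x →
      TensorialAt I E (fun Z ↦ 1 / 2 * (S.koszul X Y Z x + τ x (X x) (Y x) (Z x))) x :=
    fun X hX ↦
    { smul := fun {f Z} hf hZ ↦ by
        have := (S.tensorialAt_koszul_right hX hY).smul hf hZ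
        simp only [smul_eq_mul, Pi.smul_apply', hτ.smul_right] at this ⊢
        rw [this]; ring
      add := fun {Z Z'} hZ hZ' ↦ by
        have := (S.tensorialAt_koszul_right hX hY).add hZ hZ'
        simp only [Pi.add_apply, hτ.add_right] at this ⊢
        rw [this]; ring }
  obtain ⟨L, hL⟩ := S.exists_g_eq_bilinear (TensorialAt.mkHom₂
    (fun X Z ↦ 1 / 2 * (S.koszul X Y Z x + τ x (X x) (Y x) (Z x))) x h₁ h₂)
  refine ⟨L, fun X Z hX hZ ↦ ?_⟩
  rw [hL, TensorialAt.mkHom₂_apply h₁ h₂ hX hZ]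
  ring

open Classical in
/-- The metric connection whose torsion is a given 3-form, as a map on vector fields. -/
def koszulCov (hτ : IsSmoothThreeForm τ) (Y : Π x : M, TangentSpace I x) (x : M) :
    TangentSpace I x →L[ℝ] TangentSpace I x :=
  -- The value `0` is arbitrary: the axioms of a covariant derivative only concern points of
  -- differentiability.
  if hY : MDiffAt (T% Y) x then (S.exists_koszul_eq hτ hY).choose else 0

lemma koszulCov_spec (hτ : IsSmoothThreeForm τ) {x : M} {X Y Z : Π x : M, TangentSpace I x}
    (hX : MDiffAt (T% X) x) (hY : MDiffAt (T% Y) x) (hZ : MDiffAt (T% Z) x) :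
    2 * S.g x (S.koszulCov hτ Y x (X x)) (Z x)
      = S.koszul X Y Z x + τ x (X x) (Y x) (Z x) := by
  rw [koszulCov, dif_pos hY]
  exact (S.exists_koszul_eq hτ hY).choose_spec X Z hX hZ

/-- The metric connection whose torsion is a given 3-form. -/
def koszulConnection (hτ : IsSmoothThreeForm τ) : AffineConnection I M where
  toFun := S.koszulCov hτ
  isCovariantDerivativeOnUniv :=
    { add := fun {Y Y' x} hY hY' _ ↦ by
        ext u
        refine S.eq_of_g_eq fun w ↦ ?_
        have hu := mdifferentiableAt_extend I E u
        have hw := mdifferentiableAt_extend I E w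
        have h := S.koszulCov_spec hτ hu (mdifferentiableAt_add_section hY hY') hw
        have h₁ := S.koszulCov_spec hτ hu hY hw
        have h₂ := S.koszulCov_spec hτ hu hY' hw
        rw [S.koszul_add_middle hu hY hY' hw, Pi.add_apply, hτ.add_middle] at h
        simp only [extend_apply_self] at h h₁ h₂
        rw [_root_.add_apply, g_add_left]
        linarith
      leibniz := fun {Y f x} hY hf _ ↦ by
        ext u
        refine S.eq_of_g_eq fun w ↦ ?_
        have hu := mdifferentiableAt_extend I E u
        have hw := mdifferentiableAt_extend I E w
        have h := S.koszulCov_spec hτ hu (hf.smul_section hY) hw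
        have h₁ := S.koszulCov_spec hτ hu hY hw
        rw [S.koszul_smul_middle hf hu hY hw, Pi.smul_apply', hτ.smul_middle] at h
        simp only [extend_apply_self] at h h₁
        simp only [_root_.add_apply, _root_.smul_apply, ContinuousLinearMap.smulRight_apply,
          g_add_left, g_smul_left]
        linear_combination h / 2 - f x / 2 * h₁ }

lemma koszulConnection_spec (hτ : IsSmoothThreeForm τ) {x : M} {X Y Z : Π x : M, TangentSpace I x}
    (hX : MDiffAt (T% X) x) (hY : MDiffAt (T% Y) x) (hZ : MDiffAt (T% Z) x) :
    2 * S.g x (S.koszulConnection hτ Y x (X x)) (Z x)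
      = S.koszul X Y Z x + τ x (X x) (Y x) (Z x) :=
  S.koszulCov_spec hτ hX hY hZ

/-- Symmetrizing the Koszul formula in `Y`, `Z` leaves twice the derivative of `g(Y, Z)`; `τ` drops
out by skewness in its last two slots. -/
lemma isMetricConnection_koszulConnection (hτ : IsSmoothThreeForm τ) :
    S.IsMetricConnection (S.koszulConnection hτ) := by
  intro x u Y Z hY hZ
  have hu := mdifferentiableAt_extend I E u
  have h₁ := S.koszulConnection_spec hτ hu hY hZ
  have h₂ := S.koszulConnection_spec hτ hu hZ hY
  have h₃ := S.koszul_add_swap (extend E u) Y Z x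
  have h₄ := (hτ.skew x u (Y x) (Z x)).2
  rw [S.g_symm x (Y x)]
  simp only [extend_apply_self] at h₁ h₂ h₃
  linarith

lemma loweredTorsion_koszulConnection (hτ : IsSmoothThreeForm τ) (x : M)
    (u v w : TangentSpace I x) :
    S.loweredTorsion (S.koszulConnection hτ) x u v w = τ x u v w := by
  have hu := mdifferentiableAt_extend I E u
  have hv := mdifferentiableAt_extend I E v
  have hw := mdifferentiableAt_extend I E w
  have h := (S.koszulConnection hτ).torsion_apply_eq_extend u v
  have h₁ := S.koszulConnection_spec hτ hu hv hw
  have h₂ := S.koszulConnection_spec hτ hv hu hw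
  have h₃ := S.koszul_sub_swap (extend E u) (extend E v) (extend E w) x
  have h₄ := (hτ.skew x u v w).1
  rw [loweredTorsion, h, g_sub_left, g_sub_left]
  simp only [extend_apply_self] at h₁ h₂ h₃ ⊢
  linarith

/-- A metric connection with totally skew-symmetric torsion is determined by its torsion. -/
lemma IsMetricConnection.koszul_formula {cov : AffineConnection I M}
    (hcov : S.IsMetricConnection cov) (hskew : IsTotallySkew (S.loweredTorsion cov))
    {x : M} {X Y Z : Π x : M, TangentSpace I x}
    (hX : MDiffAt (T% X) x) (hY : MDiffAt (T% Y) x) (hZ : MDiffAt (T% Z) x) :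
    2 * S.g x (cov Y x (X x)) (Z x)
      = S.koszul X Y Z x + S.loweredTorsion cov x (X x) (Y x) (Z x) := by
  have t₁ : S.loweredTorsion cov x (X x) (Y x) (Z x) = _ :=
    congr(S.g x $(cov.torsion_apply hX hY) (Z x))
  have t₂ : S.loweredTorsion cov x (X x) (Z x) (Y x) = _ :=
    congr(S.g x $(cov.torsion_apply hX hZ) (Y x))
  have t₃ : S.loweredTorsion cov x (Y x) (Z x) (X x) = _ :=
    congr(S.g x $(cov.torsion_apply hY hZ) (X x))
  have s₁ := (hskew x (X x) (Y x) (Z x)).2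
  have s₂ := hskew.rotate x (X x) (Y x) (Z x)
  simp only [g_sub_left] at t₁ t₂ t₃
  rw [koszul, hcov x _ _ _ hY hZ, hcov x _ _ _ hX hZ, hcov x _ _ _ hX hY,
    S.g_symm x (Y x), S.g_symm x (X x), S.g_symm x (X x)]
  linarith

lemma sameConnection_of_loweredTorsion_eq {cov cov' : AffineConnection I M}
    (hcov : S.IsMetricConnection cov) (hcov' : S.IsMetricConnection cov')
    (hskew : IsTotallySkew (S.loweredTorsion cov))
    (h : ∀ (x : M) (u v w : TangentSpace I x),
      S.loweredTorsion cov' x u v w = S.loweredTorsion cov x u v w) :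
    SameConnection cov' cov := by
  have heq : S.loweredTorsion cov' = S.loweredTorsion cov := by
    funext x u v w; exact h x u v w
  intro x Y hY
  ext u
  refine S.eq_of_g_eq fun w ↦ ?_
  have hu := mdifferentiableAt_extend I E u
  have hw := mdifferentiableAt_extend I E w
  have h₁ := hcov.koszul_formula S hskew hu hY hw
  have h₂ := hcov'.koszul_formula S (heq ▸ hskew) hu hY hw
  rw [heq, ← h₁] at h₂
  simp only [extend_apply_self] at h₂
  linarith

lemma contMDiff_koszulConnection (hτ : IsSmoothThreeForm τ) :
    (S.koszulConnection hτ).ContMDiffCovariantDerivative ∞ where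
  contMDiff :=
    { contMDiff := fun {Y} hY x _ ↦ by
        have hY' : ∀ y, CMDiffAt ∞ (T% Y) y := fun y ↦
          (hY.contMDiffAt Filter.univ_mem).of_le (by simp)
        refine ContMDiffAt.contMDiffWithinAt ?_
        let b := Module.finBasis ℝ E
        set e := trivializationAt E (TangentSpace I : M → Type _) x with he
        have hx : x ∈ e.baseSet := FiberBundle.mem_baseSet_trivializationAt' x
        have hs : ∀ i, ∀ y ∈ e.baseSet, CMDiffAt ∞ (T% (e.localFrame b i)) y := fun i y hy ↦
          contMDiffAt_localFrame_of_mem ∞ e b i hy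
        -- Smoothness of `∇Y` is tested on the frame in both slots, where the Koszul formula gives a
        -- smooth function.
        refine contMDiffAt_endomorphism_of_localFrame b fun i ↦
          S.contMDiffAt_of_g_localFrame b fun j ↦ ?_
        have h := ((S.contMDiffAt_koszul (hs i x hx) (hY' x) (hs j x hx)).add
          (hτ.contMDiffAt x _ _ _ (hs i x hx) (hY' x) (hs j x hx))).div_const 2
        refine h.congr_of_eventuallyEq ?_
        filter_upwards [e.open_baseSet.mem_nhds hx] with y hy
        have := S.koszulConnection_spec hτ ((hs i y hy).mdifferentiableAt (by simp))
          ((hY' y).mdifferentiableAt (by simp)) ((hs j y hy).mdifferentiableAt (by simp))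
        exact eq_div_of_mul_eq two_ne_zero ((mul_comm _ _).trans this) }

end AlmostHermitianStructure

/-! ### `dω` and `N` in terms of `∇J` and the torsion -/

namespace AlmostHermitianStructure

variable (S : AlmostHermitianStructure I M)

/-- For trilinear `η`, the operator `Q` summing over the insertions of `J` in two slots acts by `-3`
on types (3,0), (0,3) and by `1` on (2,1), (1,2), as `J` acts by `±i`. So `(3 + Q) / 4` is the
projection. The expansion itself uses only homogeneity. -/
lemma plusPart_eq {x : M} {η : TangentSpace I x → TangentSpace I x → TangentSpace I x → ℝ}
    (h₁ : ∀ (a : ℝ) u v w, η (a • u) v w = a * η u v w)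
    (h₂ : ∀ (a : ℝ) u v w, η u (a • v) w = a * η u v w)
    (h₃ : ∀ (a : ℝ) u v w, η u v (a • w) = a * η u v w) (u v w : TangentSpace I x) :
    S.plusPart x η u v w = 3 / 4 * η u v w + 1 / 4 * (η (S.J x u) (S.J x v) w
      + η (S.J x u) v (S.J x w) + η u (S.J x v) (S.J x w)) := by
  have hneg : ∀ u : TangentSpace I x, -((1 / 2 : ℝ) • u) = (-(1 / 2) : ℝ) • u := fun u ↦ by
    rw [neg_smul]
  simp only [plusPart, complexTrilinear, Fin.sum_univ_two, part10, part01, Matrix.cons_val_zero,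
    Matrix.cons_val_one, hneg, h₁, h₂, h₃]
  simp [pow_succ]
  ring

lemma omega_field_swap (Y Z : Π x : M, TangentSpace I x) :
    (fun y ↦ S.omega y (Z y) (Y y)) = -fun y ↦ S.omega y (Y y) (Z y) := by
  funext y
  exact S.omega_swap y _ _

lemma dOmegaField_swap (X Y Z : Π x : M, TangentSpace I x) (x : M) :
    S.dOmegaField X Y Z x = -S.dOmegaField Y X Z x := by
  simp only [dOmegaField]
  rw [S.omega_field_swap Z X, S.omega_field_swap Y Z, S.omega_field_swap X Y,
    mvfderiv_neg, mvfderiv_neg, mvfderiv_neg, mlieBracket_swap_apply (V := Y) (W := X),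
    mlieBracket_swap_apply (V := X) (W := Z), mlieBracket_swap_apply (V := Z) (W := Y)]
  simp only [omega, map_neg, g_neg_left, _root_.neg_apply]
  ring

lemma dOmega_rotate (x : M) (u v w : TangentSpace I x) :
    S.dOmega x u v w = S.dOmega x v w u :=
  S.dOmegaField_rotate _ _ _ x

lemma isTotallySkew_dOmega : IsTotallySkew S.dOmega := by
  have h : ∀ (x : M) (u v w : TangentSpace I x), S.dOmega x u v w = -S.dOmega x v u w :=
    fun x u v w ↦ S.dOmegaField_swap _ _ _ x
  exact fun x u v w ↦ ⟨h x u v w, by rw [S.dOmega_rotate, h, ← S.dOmega_rotate]⟩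

lemma eventually_mdifferentiableAt {X : Π x : M, TangentSpace I x} {x : M}
    (hX : CMDiffAt ∞ (T% X) x) : ∀ᶠ y in 𝓝 x, MDiffAt (T% X) y :=
  ((contMDiffAt_iff_contMDiffAt_nhds (n := 1) (by simp)).1 (hX.of_le (by simp))).mono fun _ hy ↦
    hy.mdifferentiableAt (by simp)

lemma JField_JField (X : Π x : M, TangentSpace I x) : S.JField (S.JField X) = -X := by
  funext x
  exact S.J_J x (X x)

variable (cov : AffineConnection I M)

/-- The value of `g((∇_u J) Y, w)`. -/
def covJ (Y : Π x : M, TangentSpace I x) (x : M) (u w : TangentSpace I x) : ℝ :=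
  S.g x (cov (S.JField Y) x u - S.J x (cov Y x u)) w

/-- Differentiating `J² = -1` shows that `∇J` anticommutes with `J`, and `J` is skew for `g`. -/
lemma covJ_JField {Y : Π x : M, TangentSpace I x} {x : M} (hY : MDiffAt (T% Y) x)
    (u w : TangentSpace I x) :
    S.covJ cov (S.JField Y) x u w = S.covJ cov Y x u (S.J x w) := by
  have h : cov (-Y) x = -cov Y x := by
    have := cov.isCovariantDerivativeOnUniv.smul_const (x := x) (-1) hY
    simpa using this
  simp only [covJ, JField_JField, h, g_sub_left, _root_.neg_apply, g_neg_left, S.g_J_left]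
  rw [S.J_J, g_neg_right]
  ring

variable {cov}

/-- A metric connection preserves skewness of endomorphisms, so `∇_u J` is skew because `J` is. -/
lemma covJ_swap (hcov : S.IsMetricConnection cov) {Y Z : Π x : M, TangentSpace I x} {x : M}
    (hY : MDiffAt (T% Y) x) (hZ : MDiffAt (T% Z) x) (u : TangentSpace I x) :
    S.covJ cov Y x u (Z x) = -S.covJ cov Z x u (Y x) := by
  have h₁ := hcov x u _ _ (S.mdifferentiableAt_JField hY) hZ
  have h₂ := hcov x u _ _ (S.mdifferentiableAt_JField hZ) hY
  have h₃ : (fun y ↦ S.g y (S.JField Z y) (Y y)) = -fun y ↦ S.g y (S.JField Y y) (Z y) :=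
    S.omega_field_swap Y Z
  rw [h₃, mvfderiv_neg, _root_.neg_apply, h₁] at h₂
  simp only [covJ, g_sub_left, S.g_J_left, JField] at h₂ ⊢
  rw [S.g_symm x (Y x), S.g_symm x (Z x)] at h₂
  linarith [S.g_J_left x (cov Z x u) (Y x), S.g_J_left x (cov Y x u) (Z x)]

lemma IsHermitian.covJ_eq_zero (hcov : S.IsHermitian cov) {x : M} {Y : Π x : M, TangentSpace I x}
    (hY : MDiffAt (T% Y) x) (u w : TangentSpace I x) : S.covJ cov Y x u w = 0 := by
  rw [covJ, hcov.parallel_J x u Y hY, sub_self]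
  simp [g]

variable [CompleteSpace E] [FiniteDimensional ℝ E]

lemma dOmega_add_left (x : M) (u u' v w : TangentSpace I x) :
    S.dOmega x (u + u') v w = S.dOmega x u v w + S.dOmega x u' v w := by
  have hu := mdifferentiableAt_extend I E u
  have hu' := mdifferentiableAt_extend I E u'
  have hv := mdifferentiableAt_extend I E v
  have hw := mdifferentiableAt_extend I E w
  have h := S.dOmega_apply (mdifferentiableAt_add_section hu hu') hv hw
  have h' := (S.tensorialAt_dOmegaField hv hw).add hu hu'
  simp only [Pi.add_apply, extend_apply_self] at h
  exact h.trans h'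

lemma dOmega_smul_left (x : M) (a : ℝ) (u v w : TangentSpace I x) :
    S.dOmega x (a • u) v w = a * S.dOmega x u v w := by
  have hu := mdifferentiableAt_extend I E u
  have hv := mdifferentiableAt_extend I E v
  have hw := mdifferentiableAt_extend I E w
  have ha : MDiffAt (fun _ : M ↦ a) x := mdifferentiableAt_const
  have h := S.dOmega_apply (ha.smul_section hu) hv hw
  have h' := (S.tensorialAt_dOmegaField hv hw).smul ha hu
  simp only [Pi.smul_apply', extend_apply_self] at h
  exact h.trans h'

lemma dOmega_smul_middle (x : M) (a : ℝ) (u v w : TangentSpace I x) :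
    S.dOmega x u (a • v) w = a * S.dOmega x u v w := by
  rw [dOmega_rotate, dOmega_smul_left, ← dOmega_rotate]

lemma dOmega_smul_right (x : M) (a : ℝ) (u v w : TangentSpace I x) :
    S.dOmega x u v (a • w) = a * S.dOmega x u v w := by
  rw [dOmega_rotate, dOmega_smul_middle, ← dOmega_rotate]

/-- The extensions that define `dOmega` change with the point; near `x` they are replaced by the
fixed fields `X`, `Y`, `Z`. -/
lemma contMDiffAt_dOmega {X Y Z : Π x : M, TangentSpace I x} {x : M}
    (hX : CMDiffAt ∞ (T% X) x) (hY : CMDiffAt ∞ (T% Y) x) (hZ : CMDiffAt ∞ (T% Z) x) :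
    ContMDiffAt I 𝓘(ℝ) ∞ (fun y ↦ S.dOmega y (X y) (Y y) (Z y)) x := by
  have h : ContMDiffAt I 𝓘(ℝ) ∞ (S.dOmegaField X Y Z) x :=
    (((((((S.contMDiffAt_omega hY hZ).mvfderiv_apply_section hX).add
      ((S.contMDiffAt_omega hZ hX).mvfderiv_apply_section hY)).add
      ((S.contMDiffAt_omega hX hY).mvfderiv_apply_section hZ)).sub
      (S.contMDiffAt_omega (contMDiffAt_mlieBracket hX hY) hZ)).sub
      (S.contMDiffAt_omega (contMDiffAt_mlieBracket hY hZ) hX)).sub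
      (S.contMDiffAt_omega (contMDiffAt_mlieBracket hZ hX) hY))
  refine h.congr_of_eventuallyEq ?_
  filter_upwards [eventually_mdifferentiableAt hX, eventually_mdifferentiableAt hY,
    eventually_mdifferentiableAt hZ] with y hX hY hZ
  exact S.dOmega_apply hX hY hZ

lemma contMDiffAt_loweredNijenhuis {X Y Z : Π x : M, TangentSpace I x} {x : M}
    (hX : CMDiffAt ∞ (T% X) x) (hY : CMDiffAt ∞ (T% Y) x) (hZ : CMDiffAt ∞ (T% Z) x) :
    ContMDiffAt I 𝓘(ℝ) ∞ (fun y ↦ S.loweredNijenhuis y (X y) (Y y) (Z y)) x := by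
  have hJX := S.contMDiffAt_JField hX
  have hJY := S.contMDiffAt_JField hY
  have h : ContMDiffAt I 𝓘(ℝ) ∞ (fun y ↦ S.g y (S.nijenhuisField X Y y) (Z y)) x := by
    simp only [nijenhuisField, g_sub_left, g_add_left]
    exact (((S.contMDiffAt_g (S.contMDiffAt_JField (contMDiffAt_mlieBracket hJX hY)) hZ).add
      (S.contMDiffAt_g (S.contMDiffAt_JField (contMDiffAt_mlieBracket hX hJY)) hZ)).add
      (S.contMDiffAt_g (contMDiffAt_mlieBracket hX hY) hZ)).sub
      (S.contMDiffAt_g (contMDiffAt_mlieBracket hJX hJY) hZ)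
  refine h.congr_of_eventuallyEq ?_
  filter_upwards [eventually_mdifferentiableAt hX, eventually_mdifferentiableAt hY] with y hX hY
  rw [loweredNijenhuis, S.nijenhuis_apply hX hY]

/-- The 3-form `dω(JX, JY, JZ) - g(N(X, Y), Z)`. -/
def skewTorsion (x : M) (u v w : TangentSpace I x) : ℝ :=
  S.dOmega x (S.J x u) (S.J x v) (S.J x w) - S.loweredNijenhuis x u v w

lemma isSmoothThreeForm_skewTorsion (hN : IsTotallySkew S.loweredNijenhuis) :
    IsSmoothThreeForm S.skewTorsion where
  skew x u v w := by
    have h := S.isTotallySkew_dOmega x (S.J x u) (S.J x v) (S.J x w)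
    simp only [skewTorsion]
    exact ⟨by rw [h.1, (hN x u v w).1]; ring, by rw [h.2, (hN x u v w).2]; ring⟩
  add_left x u u' v w := by
    simp only [skewTorsion, loweredNijenhuis, map_add, _root_.add_apply, dOmega_add_left,
      g_add_left]
    ring
  smul_left x a u v w := by
    simp only [skewTorsion, loweredNijenhuis, map_smul, _root_.smul_apply, dOmega_smul_left,
      g_smul_left]
    ring
  contMDiffAt x X Y Z hX hY hZ :=
    (S.contMDiffAt_dOmega (S.contMDiffAt_JField hX) (S.contMDiffAt_JField hY)
      (S.contMDiffAt_JField hZ)).sub (S.contMDiffAt_loweredNijenhuis hX hY hZ)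

lemma mlieBracket_eq {X Y : Π x : M, TangentSpace I x} {x : M}
    (hX : MDiffAt (T% X) x) (hY : MDiffAt (T% Y) x) :
    mlieBracket I X Y x = cov Y x (X x) - cov X x (Y x) - cov.torsion x (X x) (Y x) := by
  rw [cov.torsion_apply hX hY]
  abel

/-- Brackets are replaced by covariant derivatives minus torsion. The derivatives of the fields then
cancel, except in the combination `∇(JY) - J∇Y`. -/
lemma dOmega_eq (hcov : S.IsMetricConnection cov) {X Y Z : Π x : M, TangentSpace I x} {x : M}
    (hX : MDiffAt (T% X) x) (hY : MDiffAt (T% Y) x) (hZ : MDiffAt (T% Z) x) :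
    S.dOmega x (X x) (Y x) (Z x) =
      S.covJ cov Y x (X x) (Z x) + S.covJ cov Z x (Y x) (X x) + S.covJ cov X x (Z x) (Y x)
      - S.loweredTorsion cov x (X x) (Y x) (S.J x (Z x))
      - S.loweredTorsion cov x (Y x) (Z x) (S.J x (X x))
      - S.loweredTorsion cov x (Z x) (X x) (S.J x (Y x)) := by
  have d : ∀ {Y Z : Π x : M, TangentSpace I x} (u : TangentSpace I x), MDiffAt (T% Y) x →
      MDiffAt (T% Z) x → d% (fun y ↦ S.omega y (Y y) (Z y)) x u
        = S.g x (cov (S.JField Y) x u) (Z x) + S.g x (S.JField Y x) (cov Z x u) :=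
    fun u hY hZ ↦ hcov x u _ _ (S.mdifferentiableAt_JField hY) hZ
  rw [S.dOmega_apply hX hY hZ, dOmegaField, d _ hY hZ, d _ hZ hX, d _ hX hY,
    mlieBracket_eq (cov := cov) hX hY, mlieBracket_eq (cov := cov) hY hZ,
    mlieBracket_eq (cov := cov) hZ hX, S.g_symm x (S.JField X x), S.g_symm x (S.JField Y x),
    S.g_symm x (S.JField Z x)]
  simp only [covJ, loweredTorsion, omega, JField, g_sub_left, S.g_J_left]
  ring

lemma loweredNijenhuis_eq {X Y : Π x : M, TangentSpace I x} {x : M}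
    (hX : MDiffAt (T% X) x) (hY : MDiffAt (T% Y) x) (w : TangentSpace I x) :
    S.loweredNijenhuis x (X x) (Y x) w =
      -S.covJ cov Y x (X x) (S.J x w) + S.covJ cov X x (Y x) (S.J x w)
      - S.covJ cov Y x (S.J x (X x)) w + S.covJ cov X x (S.J x (Y x)) w
      + S.loweredTorsion cov x (S.J x (X x)) (Y x) (S.J x w)
      + S.loweredTorsion cov x (X x) (S.J x (Y x)) (S.J x w)
      - S.loweredTorsion cov x (X x) (Y x) w
      + S.loweredTorsion cov x (S.J x (X x)) (S.J x (Y x)) w := by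
  have hJX := S.mdifferentiableAt_JField hX
  have hJY := S.mdifferentiableAt_JField hY
  rw [loweredNijenhuis, S.nijenhuis_apply hX hY, nijenhuisField,
    mlieBracket_eq (cov := cov) hX hY, mlieBracket_eq (cov := cov) hJX hY,
    mlieBracket_eq (cov := cov) hX hJY, mlieBracket_eq (cov := cov) hJX hJY]
  simp only [covJ, loweredTorsion, JField, g_sub_left, g_add_left, S.g_J_left, S.J_J, g_neg_right]
  ring

end AlmostHermitianStructure

/-! ### The candidate torsion makes `J` parallel -/

namespace AlmostHermitianStructure

variable (S : AlmostHermitianStructure I M) [CompleteSpace E] [FiniteDimensional ℝ E]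
  {cov : AffineConnection I M}

lemma loweredTorsion_neg_left (x : M) (u v w : TangentSpace I x) :
    S.loweredTorsion cov x (-u) v w = -S.loweredTorsion cov x u v w := by
  simp [loweredTorsion, g_neg_left]

lemma loweredTorsion_neg_middle (x : M) (u v w : TangentSpace I x) :
    S.loweredTorsion cov x u (-v) w = -S.loweredTorsion cov x u v w := by
  simp [loweredTorsion, g_neg_left]

lemma loweredTorsion_neg_right (x : M) (u v w : TangentSpace I x) :
    S.loweredTorsion cov x u v (-w) = -S.loweredTorsion cov x u v w := by
  simp [loweredTorsion, g_neg_right]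

lemma dOmega_neg_left (x : M) (u v w : TangentSpace I x) :
    S.dOmega x (-u) v w = -S.dOmega x u v w := by
  simpa using S.dOmega_smul_left x (-1) u v w

lemma dOmega_neg_middle (x : M) (u v w : TangentSpace I x) :
    S.dOmega x u (-v) w = -S.dOmega x u v w := by
  simpa using S.dOmega_smul_middle x (-1) u v w

lemma dOmega_neg_right (x : M) (u v w : TangentSpace I x) :
    S.dOmega x u v (-w) = -S.dOmega x u v w := by
  simpa using S.dOmega_smul_right x (-1) u v w

lemma thetaB_eq (x : M) (u v w : TangentSpace I x) :
    S.thetaB x u v w = 3 / 4 * S.dOmega x (S.J x u) (S.J x v) (S.J x w)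
      + 1 / 4 * (S.dOmega x u v (S.J x w) + S.dOmega x u (S.J x v) w
        + S.dOmega x (S.J x u) v w) := by
  rw [thetaB, dOmegaPlus, S.plusPart_eq (S.dOmega_smul_left x) (S.dOmega_smul_middle x)
    (S.dOmega_smul_right x)]
  simp only [J_J, dOmega_neg_left, dOmega_neg_middle, dOmega_neg_right, neg_neg]

/-- If the metric connection `cov` has torsion `dω(JX, JY, JZ) - g(N(X, Y), Z)` and this torsion
is totally skew-symmetric, then `cov` preserves `J`. -/
lemma covJ_eq_zero (hcov : S.IsMetricConnection cov) (hskew : IsTotallySkew (S.loweredTorsion cov))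
    (htor : ∀ (x : M) (u v w : TangentSpace I x),
      S.loweredTorsion cov x u v w = S.skewTorsion x u v w)
    {x : M} {X Y Z : Π x : M, TangentSpace I x}
    (hX : MDiffAt (T% X) x) (hY : MDiffAt (T% Y) x) (hZ : MDiffAt (T% Z) x) :
    S.covJ cov Y x (X x) (Z x) = 0 := by
  -- In `T = dω(J·, J·, J·) - N` all torsion terms cancel by rotation; this is what remains of the
  -- `∇J` terms.
  have key : ∀ U V W : Π x : M, TangentSpace I x, MDiffAt (T% U) x → MDiffAt (T% V) x →
      MDiffAt (T% W) x → S.covJ cov U x (W x) (V x) =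
        S.covJ cov V x (U x) (W x) + S.covJ cov W x (V x) (U x) := by
    intro U V W' hU hV hW'
    -- The surviving relation contains the third field only through `JW`; taking `W = JW'` turns
    -- this into `-W'`.
    let W := S.JField W'
    have hW : MDiffAt (T% W) x := S.mdifferentiableAt_JField hW'
    have hJU := S.mdifferentiableAt_JField hU
    have hJV := S.mdifferentiableAt_JField hV
    have hJW := S.mdifferentiableAt_JField hW
    have h₁ := S.dOmega_eq hcov hJU hJV hJW
    have h₂ := htor x (U x) (V x) (W x)
    have s₁ := hskew.rotate x (U x) (S.J x (V x)) (S.J x (W x))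
    have s₂ := hskew.rotate x (S.J x (W x)) (S.J x (U x)) (V x)
    have s₃ := S.covJ_swap hcov hV hW (S.J x (U x))
    have s₄ := S.covJ_swap hcov hW hU (S.J x (V x))
    have s₅ := S.covJ_swap hcov hW' hU (V x)
    have s₆ := S.covJ_swap hcov hV hW' (U x)
    rw [S.covJ_JField cov hU, S.covJ_JField cov hV, S.covJ_JField cov hW] at h₁
    rw [skewTorsion, S.loweredNijenhuis_eq (cov := cov) hU hV] at h₂
    have e : ∀ (Q : Π x : M, TangentSpace I x), S.JField Q x = S.J x (Q x) := fun _ ↦ rfl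
    have hWx : S.J x (W x) = -W' x := S.J_J x _
    have hW'x : S.J x (-W' x) = -W x := map_neg _ _
    have n₁ : ∀ (Q : Π x : M, TangentSpace I x) (u w : TangentSpace I x),
      S.covJ cov Q x (-u) w = -S.covJ cov Q x u w := fun Q u w ↦ by
        simp only [covJ, map_neg, g_sub_left, g_neg_left]; ring
    have n₂ : ∀ (Q : Π x : M, TangentSpace I x) (u w : TangentSpace I x),
      S.covJ cov Q x u (-w) = -S.covJ cov Q x u w := fun Q u w ↦ by
        simp only [covJ, g_neg_right]
    simp only [e, J_J, n₁, n₂, loweredTorsion_neg_left, loweredTorsion_neg_middle,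
      loweredTorsion_neg_right, hWx, hW'x] at h₁ h₂ s₁ s₂ s₃ s₄
    linarith
  -- Each of three numbers is the sum of the other two, so all vanish.
  have k₁ := key X Y Z hX hY hZ
  have k₂ := key Y Z X hY hZ hX
  have k₃ := key Z X Y hZ hX hY
  linarith

end AlmostHermitianStructure

/-! ### Hermitian connections with skew torsion -/

namespace AlmostHermitianStructure

variable (S : AlmostHermitianStructure I M) [CompleteSpace E] [FiniteDimensional ℝ E]
  {cov : AffineConnection I M}

lemma IsHermitian.dOmega_eq (hcov : S.IsHermitian cov) (x : M) (u v w : TangentSpace I x) :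
    S.dOmega x u v w = -S.loweredTorsion cov x u v (S.J x w)
      - S.loweredTorsion cov x v w (S.J x u) - S.loweredTorsion cov x w u (S.J x v) := by
  have hu := mdifferentiableAt_extend I E u
  have hv := mdifferentiableAt_extend I E v
  have hw := mdifferentiableAt_extend I E w
  have h := S.dOmega_eq hcov.metric hu hv hw
  rw [hcov.covJ_eq_zero S hu, hcov.covJ_eq_zero S hv, hcov.covJ_eq_zero S hw] at h
  simp only [extend_apply_self] at h
  linarith

lemma IsHermitian.loweredNijenhuis_eq (hcov : S.IsHermitian cov) (x : M)
    (u v w : TangentSpace I x) :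
    S.loweredNijenhuis x u v w = S.loweredTorsion cov x (S.J x u) v (S.J x w)
      + S.loweredTorsion cov x u (S.J x v) (S.J x w) - S.loweredTorsion cov x u v w
      + S.loweredTorsion cov x (S.J x u) (S.J x v) w := by
  have hu := mdifferentiableAt_extend I E u
  have hv := mdifferentiableAt_extend I E v
  have h := S.loweredNijenhuis_eq (cov := cov) hu hv w
  simp only [hcov.covJ_eq_zero S hu, hcov.covJ_eq_zero S hv, extend_apply_self] at h
  linarith

/-- `N + T` is the sum of `T` over all insertions of `J` in two slots; transposing arguments
permutes these insertions. -/
lemma IsHermitian.isTotallySkew_loweredNijenhuis (hcov : S.IsHermitian cov)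
    (hskew : IsTotallySkew (S.loweredTorsion cov)) : IsTotallySkew S.loweredNijenhuis := by
  intro x u v w
  simp only [hcov.loweredNijenhuis_eq S]
  constructor
  · linarith [(hskew x (S.J x u) v (S.J x w)).1, (hskew x u (S.J x v) (S.J x w)).1,
      (hskew x u v w).1, (hskew x (S.J x u) (S.J x v) w).1]
  · linarith [(hskew x (S.J x u) v (S.J x w)).2, (hskew x u (S.J x v) (S.J x w)).2,
      (hskew x u v w).2, (hskew x (S.J x u) (S.J x v) w).2]

lemma IsHermitian.loweredTorsion_eq (hcov : S.IsHermitian cov)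
    (hskew : IsTotallySkew (S.loweredTorsion cov)) (x : M) (u v w : TangentSpace I x) :
    S.loweredTorsion cov x u v w = S.skewTorsion x u v w := by
  rw [skewTorsion, hcov.loweredNijenhuis_eq S, hcov.dOmega_eq S]
  simp only [J_J, loweredTorsion_neg_right]
  linarith [hskew.rotate x u (S.J x v) (S.J x w), hskew.rotate x (S.J x w) (S.J x u) v]

/-- At `t = 2` the `thetaC` term vanishes. With `P` the sum of `T` over insertions of two `J`s, `N =
P - T`, `dω(J·, J·, J·) = P`, and inserting one `J` in `dω` in all ways gives `3T - 2P`. The total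
is `-(P - T)/4 + 3P/4 + (3T - 2P)/4 = T`. -/
lemma IsHermitian.gauduchonTorsion_two_eq (hcov : S.IsHermitian cov)
    (hskew : IsTotallySkew (S.loweredTorsion cov)) (x : M) (u v w : TangentSpace I x) :
    S.gauduchonTorsion 2 x u v w = S.loweredTorsion cov x u v w := by
  rw [gauduchonTorsion, thetaB_eq, hcov.loweredNijenhuis_eq S]
  simp only [hcov.dOmega_eq S, J_J, loweredTorsion_neg_right]
  linarith [hskew.rotate x u (S.J x v) (S.J x w), hskew.rotate x (S.J x w) (S.J x u) v,
    hskew.rotate x (S.J x u) v (S.J x w), hskew.rotate x (S.J x w) u (S.J x v),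
    hskew.rotate x (S.J x u) (S.J x v) w, hskew.rotate x w (S.J x u) (S.J x v),
    hskew.rotate x u v w, hskew.rotate x w u v]

lemma isHermitian_koszulConnection_skewTorsion (hN : IsTotallySkew S.loweredNijenhuis) :
    S.IsHermitian (S.koszulConnection (S.isSmoothThreeForm_skewTorsion hN)) where
  smooth := S.contMDiff_koszulConnection _
  metric := S.isMetricConnection_koszulConnection _
  parallel_J x u Y hY := by
    have hτ := S.isSmoothThreeForm_skewTorsion hN
    have htor := S.loweredTorsion_koszulConnection hτ
    have hskew : IsTotallySkew (S.loweredTorsion (S.koszulConnection hτ)) := by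
      intro x u v w
      simpa only [htor] using hτ.skew x u v w
    refine S.eq_of_g_eq fun w ↦ ?_
    have h := S.covJ_eq_zero (S.isMetricConnection_koszulConnection hτ) hskew htor
      (mdifferentiableAt_extend I E u) hY (mdifferentiableAt_extend I E w)
    simp only [covJ, g_sub_left, extend_apply_self] at h
    linarith

end AlmostHermitianStructure

end

theorem mainTheorem7 {E : Type*} [NormedAddCommGroup E] [NormedSpace ℝ E]
    [FiniteDimensional ℝ E] [CompleteSpace E]
    {H : Type*} [TopologicalSpace H] {I : ModelWithCorners ℝ E H}
    {M : Type*} [TopologicalSpace M] [ChartedSpace H M] [IsManifold I ∞ M]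
    [BoundarylessManifold I M] [T2Space M] [SecondCountableTopology M]
    (S : AlmostHermitianStructure I M) :
    ((∃ cov : AffineConnection I M,
        S.IsHermitian cov ∧ IsTotallySkew (S.loweredTorsion cov)) ↔
      IsTotallySkew S.loweredNijenhuis) ∧
    (IsTotallySkew S.loweredNijenhuis →
      ∃ cov : AffineConnection I M,
        S.IsHermitian cov ∧ IsTotallySkew (S.loweredTorsion cov) ∧
        (∀ cov' : AffineConnection I M,
          S.IsHermitian cov' → IsTotallySkew (S.loweredTorsion cov') →
            SameConnection cov' cov) ∧
        S.IsGauduchon 2 cov ∧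
        (∀ cov' : AffineConnection I M, S.IsGauduchon 2 cov' → SameConnection cov' cov) ∧
        ∀ (x : M) (u v w : TangentSpace I x),
          S.loweredTorsion cov x u v w
            = S.dOmega x (S.J x u) (S.J x v) (S.J x w) - S.loweredNijenhuis x u v w) := by
  have hforward : ∀ cov : AffineConnection I M, S.IsHermitian cov →
      IsTotallySkew (S.loweredTorsion cov) → IsTotallySkew S.loweredNijenhuis :=
    fun cov hcov hskew ↦ hcov.isTotallySkew_loweredNijenhuis S hskew
  have hmain : IsTotallySkew S.loweredNijenhuis → ∃ cov : AffineConnection I M,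
      S.IsHermitian cov ∧ ∀ (x : M) (u v w : TangentSpace I x),
        S.loweredTorsion cov x u v w = S.skewTorsion x u v w := fun hN ↦
    ⟨_, S.isHermitian_koszulConnection_skewTorsion hN, S.loweredTorsion_koszulConnection _⟩
  have hskew : ∀ cov : AffineConnection I M, IsTotallySkew S.loweredNijenhuis →
      (∀ (x : M) (u v w : TangentSpace I x),
        S.loweredTorsion cov x u v w = S.skewTorsion x u v w) →
      IsTotallySkew (S.loweredTorsion cov) := by
    intro cov hN htor x u v w
    simpa only [htor] using (S.isSmoothThreeForm_skewTorsion hN).skew x u v w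
  refine ⟨⟨fun ⟨cov, hcov, hs⟩ ↦ hforward cov hcov hs, fun hN ↦ ?_⟩, fun hN ↦ ?_⟩
  · obtain ⟨cov, hcov, htor⟩ := hmain hN
    exact ⟨cov, hcov, hskew cov hN htor⟩
  · obtain ⟨cov, hcov, htor⟩ := hmain hN
    have hs := hskew cov hN htor
    have hG : ∀ (x : M) (u v w : TangentSpace I x),
        S.loweredTorsion cov x u v w = S.gauduchonTorsion 2 x u v w := fun x u v w ↦
      (hcov.gauduchonTorsion_two_eq S hs x u v w).symm
    refine ⟨cov, hcov, hs, fun cov' hcov' hs' ↦ ?_, ⟨hcov.smooth, hcov.metric, hG⟩,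
      fun cov' hcov' ↦ ?_, htor⟩
    · exact S.sameConnection_of_loweredTorsion_eq hcov.metric hcov'.metric hs fun x u v w ↦ by
        rw [hcov'.loweredTorsion_eq S hs', htor]
    -- `∇J = 0` is not known for `cov'`, but being metric with the same skew torsion suffices.
    · exact S.sameConnection_of_loweredTorsion_eq hcov.metric hcov'.metric hs fun x u v w ↦ by
        rw [hcov'.torsion_eq, hG]
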